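/- Call a tree a caterpillar if removing all its leaves (vertices of degree $1$) leaves a path, called its spine; for an integer $\Delta\ge 2$, a caterpillar is $\Delta$-regular if its spine is non-empty and every spine vertex has degree $\Delta$. A packing of $n$-vertex graphs $G_1,\dots,G_h$ is an $n$-vertex graph that contains (copies of) $G_1,\dots,G_h$ as pairwise edge-disjoint spanning subgraphs. A graph is $k$-planar if it has a drawing in the plane (vertices are distinct points, every edge is a simple arc joining its end-vertices and passing through no other vertex) in which each edge is crossed at most $k$ times. Theorem. There is an absolute constant $K$ such that the following holds for all integers $n\ge 1$ and $h\ge 1$. Let $C_1,\dots,C_h$ be $n$-vertex caterpillars such that $C_i$ is $\Delta_i$-regular and $\Delta_i\le n-h$ for $1\le i\le h$, and $\Delta_i-1$ is a multiple of $\Delta_{i+1}-1$ for $1\le i<h$. If $n\ge 2h+(\Delta_1-1)$, then there is a packing of $C_1,\dots,C_h$ that is $k$-planar for some $k\le K(\Delta_1h+h^2)$; that is, $C_1,\dots,C_h$ admit a $k$-planar packing with $k\in O(\Delta_1h+h^2)$. -/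

import Mathlib

namespace CaterpillarPacking

/-- The degree of `v` in `G`. -/
noncomputable def deg {V : Type*} [Fintype V] (G : SimpleGraph V) (v : V) : ℕ :=
  open scoped Classical in G.degree v

/-- The set of vertices that remain after removing all leaves (vertices of degree one). -/
def spine {V : Type*} [Fintype V] (G : SimpleGraph V) : Set V :=
  {v | deg G v ≠ 1}

/-- A caterpillar is a tree such that removing all leaves leaves a path. -/
def IsCaterpillar {V : Type*} [Fintype V] (G : SimpleGraph V) : Prop :=
  G.IsTree ∧ ∃ σ : ℕ, Nonempty (G.induce (spine G) ≃g SimpleGraph.pathGraph σ)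

/-- A `Δ`-regular caterpillar, `Δ ≥ 2`: a caterpillar with at least one spine vertex, all of whose
spine vertices have degree `Δ`. -/
structure IsRegularCaterpillar {V : Type*} [Fintype V] (G : SimpleGraph V) (Δ : ℕ) : Prop where
  two_le : 2 ≤ Δ
  isCaterpillar : IsCaterpillar G
  spine_nonempty : (spine G).Nonempty
  degree_eq : ∀ v ∈ spine G, deg G v = Δ

/-- `G` is a packing of the graphs `H i`: each `H i` can be placed on all of the vertices of `G`
by a bijection `f i`, so that the copies are spanning subgraphs of `G` and are pairwise
edge-disjoint. -/
def IsPacking {ι W : Type*} {V : ι → Type*} (H : ∀ i, SimpleGraph (V i)) (G : SimpleGraph W) :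
    Prop :=
  ∃ f : ∀ i, V i ≃ W,
    (∀ i, (H i).map (f i).toEmbedding ≤ G) ∧
    Pairwise fun i j =>
      Disjoint ((H i).map (f i).toEmbedding).edgeSet ((H j).map (f j).toEmbedding).edgeSet

/-- A drawing of a graph in the plane: distinct vertices are distinct points, every edge is a
simple arc that joins the points of its two end-vertices and contains no other vertex. -/
structure Drawing {V : Type*} (G : SimpleGraph V) where
  /-- the point that represents a vertex -/
  point : V → ℝ × ℝ
  point_injective : Function.Injective point
  /-- the arc that represents an edge -/
  arc : G.edgeSet → unitInterval → ℝ × ℝ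
  arc_continuous : ∀ e, Continuous (arc e)
  arc_injective : ∀ e, Function.Injective (arc e)
  arc_ends : ∀ e : G.edgeSet, s(arc e 0, arc e 1) = (e : Sym2 V).map point
  arc_avoids : ∀ e, ∀ t ∈ Set.Ioo (0 : unitInterval) 1, ∀ v, arc e t ≠ point v

/-- The relative interior of the arc of the edge `e`. -/
def Drawing.interior {V : Type*} {G : SimpleGraph V} (D : Drawing G) (e : G.edgeSet) :
    Set (ℝ × ℝ) :=
  D.arc e '' Set.Ioo (0 : unitInterval) 1

/-- The crossings along the edge `e`: the pairs of another edge `f` and a common interior point of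
`e` and `f`. A point shared by several other edges is counted once for each of them. -/
def Drawing.crossings {V : Type*} {G : SimpleGraph V} (D : Drawing G) (e : G.edgeSet) :
    Set (G.edgeSet × (ℝ × ℝ)) :=
  {x | x.1 ≠ e ∧ x.2 ∈ D.interior e ∧ x.2 ∈ D.interior x.1}

/-- A graph is `k`-planar if it has a drawing in the plane in which every edge is crossed at most
`k` times. -/
def IsKPlanar {V : Type*} (G : SimpleGraph V) (k : ℕ) : Prop :=
  ∃ D : Drawing G, ∀ e : G.edgeSet, (D.crossings e).encard ≤ k

end CaterpillarPacking

/-!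
Draw a `Δ`-regular caterpillar on the integers as a zigzag with edges of lengths `1, 2, 3, …`, in
which each spine vertex is the common end of `d + 1 = Δ` consecutive edges. The right ends of the
edges move along a staircase with steps of size `d`, and the vertices occupy an interval of `n`
consecutive integers. Shift the `i`-th caterpillar by `i` and reduce modulo `n`. Edges of two
caterpillars can only coincide if they have the same index in their zigzags. But if `d'` divides
`d`, then the staircase of `d'` is never behind that of `d`, so that its larger shift keeps the
edges apart.

Place the vertices in convex position. An edge that wraps around modulo `n` is a chord whose ends
have a sum that is known up to `Δ + 2 h`. Two such chords are nearly parallel, hence can only cross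
if they have nearly the same length. All other edges have length less than `2 h`. Therefore an edge
only crosses edges whose index differs by `O(Δ + h)` from its own, in each of `h` caterpillars.
-/

namespace CaterpillarPacking

open SimpleGraph

section Staircase

/-- The number of right steps among the first `t` steps of the lattice path that alternates between
`d` steps upwards and `d` steps to the right. -/
def rightSteps (d t : ℕ) : ℕ := Nat.count (fun s => Odd (s / d)) t

lemma rightSteps_zero (d : ℕ) : rightSteps d 0 = 0 := Nat.count_zero _

lemma rightSteps_mono (d : ℕ) : Monotone (rightSteps d) := Nat.count_monotone _

lemma rightSteps_add_le (d t s : ℕ) : rightSteps d (t + s) ≤ rightSteps d t + s := by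
  rw [rightSteps, Nat.count_add]
  exact Nat.add_le_add_left (Nat.count_le _) _

lemma rightSteps_mul_add_of_even {d k r : ℕ} (hk : Even k) (hr : r ≤ d) :
    rightSteps d (k * d + r) = rightSteps d (k * d) := by
  rw [rightSteps, rightSteps, Nat.count_add, Nat.add_eq_left]
  refine Nat.count_of_forall_not fun s hs => ?_
  rwa [add_comm, Nat.add_mul_div_right _ _ (by omega), Nat.div_eq_of_lt (by omega), zero_add,
    Nat.not_odd_iff_even]

lemma rightSteps_mul_add_of_odd {d k r : ℕ} (hk : Odd k) (hr : r ≤ d) :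
    rightSteps d (k * d + r) = rightSteps d (k * d) + r := by
  rw [rightSteps, rightSteps, Nat.count_add, Nat.add_right_inj]
  refine Nat.count_of_forall fun s hs => ?_
  rwa [add_comm, Nat.add_mul_div_right _ _ (by omega), Nat.div_eq_of_lt (by omega), zero_add]

lemma rightSteps_two_mul_mul (d m : ℕ) : rightSteps d (2 * m * d) = m * d := by
  induction m with
  | zero => simp [rightSteps_zero]
  | succ m ih =>
    rw [show 2 * (m + 1) * d = (2 * m + 1) * d + d by ring,
      rightSteps_mul_add_of_odd (odd_two_mul_add_one m) le_rfl, add_one_mul (2 * m),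
      rightSteps_mul_add_of_even (even_two_mul m) le_rfl, ih, add_one_mul]

lemma rightSteps_eq_of_even {d m t : ℕ} (h₁ : 2 * m * d ≤ t) (h₂ : t ≤ (2 * m + 1) * d) :
    rightSteps d t = m * d := by
  obtain ⟨r, rfl⟩ := Nat.exists_eq_add_of_le h₁
  rw [rightSteps_mul_add_of_even (even_two_mul m) (by linarith), rightSteps_two_mul_mul]

lemma rightSteps_eq_of_odd {d m t : ℕ} (h₁ : (2 * m + 1) * d ≤ t) (h₂ : t ≤ (2 * m + 2) * d) :
    rightSteps d t + (m + 1) * d = t := by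
  obtain ⟨r, rfl⟩ := Nat.exists_eq_add_of_le h₁
  rw [rightSteps_mul_add_of_odd (odd_two_mul_add_one m) (by linarith),
    rightSteps_eq_of_even (by linarith) le_rfl]
  ring

lemma exists_block {d : ℕ} (hd : 0 < d) (t : ℕ) :
    ∃ m, 2 * m * d ≤ t ∧ t ≤ (2 * m + 1) * d ∨ (2 * m + 1) * d ≤ t ∧ t ≤ (2 * m + 2) * d := by
  have h₁ := Nat.div_mul_le_self t d
  have h₂ := (Nat.lt_mul_of_div_lt (Nat.lt_succ_self (t / d)) hd).le
  obtain ⟨m, h | h⟩ := Nat.even_or_odd' (t / d) <;> rw [h] at h₁ h₂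
  exacts [⟨m, .inl ⟨h₁, h₂⟩⟩, ⟨m, .inr ⟨h₁, h₂⟩⟩]

lemma two_mul_rightSteps_le {d : ℕ} (hd : 0 < d) (t : ℕ) : 2 * rightSteps d t ≤ t := by
  obtain ⟨m, ⟨h₁, h₂⟩ | ⟨h₁, h₂⟩⟩ := exists_block hd t
  · linarith [rightSteps_eq_of_even h₁ h₂]
  · linarith [rightSteps_eq_of_odd h₁ h₂]

lemma le_two_mul_rightSteps_add {d : ℕ} (hd : 0 < d) (t : ℕ) : t ≤ 2 * rightSteps d t + d := by
  obtain ⟨m, ⟨h₁, h₂⟩ | ⟨h₁, h₂⟩⟩ := exists_block hd t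
  · linarith [rightSteps_eq_of_even h₁ h₂]
  · linarith [rightSteps_eq_of_odd h₁ h₂]

lemma rightSteps_le_of_dvd {d d' : ℕ} (hd : 0 < d) (h : d' ∣ d) (t : ℕ) :
    rightSteps d t ≤ rightSteps d' t := by
  have corner : ∀ m, rightSteps d' (2 * m * d) = m * d := fun m => by
    obtain ⟨c, rfl⟩ := h
    rw [show 2 * m * (d' * c) = 2 * (m * c) * d' by ring, rightSteps_two_mul_mul]
    ring
  obtain ⟨m, ⟨h₁, h₂⟩ | ⟨h₁, h₂⟩⟩ := exists_block hd t
  · rw [rightSteps_eq_of_even h₁ h₂, ← corner]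
    exact rightSteps_mono d' h₁
  · have h₃ := rightSteps_eq_of_odd h₁ h₂
    have h₄ := corner (m + 1)
    obtain ⟨s, hs⟩ := Nat.exists_eq_add_of_le h₂
    rw [mul_add_one, hs] at h₄
    linarith [rightSteps_add_le d' t s]

/-- The `t`-th edge of the zigzag drawing of a caterpillar on the integers: the edge lengths are
`1, 2, 3, …`, and consecutive edges share their left ends along a right step and their right ends
along an upward step of the staircase. -/
def zigzagEdge (d t : ℕ) : Sym2 ℤ := s((rightSteps d t : ℤ), rightSteps d t - (t + 1))

lemma exists_mem_zigzagEdge (d : ℕ) {N : ℕ} {z : ℤ} (h₁ : rightSteps d N - (N + 1) ≤ z)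
    (h₂ : z ≤ rightSteps d N) : ∃ t ≤ N, z ∈ zigzagEdge d t := by
  induction N with
  | zero =>
    rw [rightSteps_zero] at h₁ h₂
    refine ⟨0, le_rfl, Sym2.mem_iff.2 ?_⟩
    rw [rightSteps_zero]
    omega
  | succ N ih =>
    by_cases hz : z ∈ zigzagEdge d (N + 1)
    · exact ⟨N + 1, le_rfl, hz⟩
    · rw [zigzagEdge, Sym2.mem_iff, not_or] at hz
      have h₃ := rightSteps_add_le d N 1
      have h₄ := rightSteps_mono d (Nat.le_add_right N 1)
      push_cast at h₁ hz
      obtain ⟨t, ht, hzt⟩ := ih (by omega) (by omega)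
      exact ⟨t, by omega, hzt⟩

/-- The position of the `k`-th spine vertex in the zigzag drawing. -/
def spinePos (d k : ℕ) : ℤ := if Even k then (k / 2 * d : ℕ) else -1 - ((k + 1) / 2 * d : ℕ)

lemma spinePos_mem_zigzagEdge {d k t : ℕ} (h₁ : k * d ≤ t) (h₂ : t ≤ (k + 1) * d) :
    spinePos d k ∈ zigzagEdge d t := by
  rw [zigzagEdge, Sym2.mem_iff]
  obtain ⟨m, rfl | rfl⟩ := Nat.even_or_odd' k
  · left
    simp [spinePos, rightSteps_eq_of_even h₁ h₂]
  · right
    have h₃ := rightSteps_eq_of_odd h₁ h₂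
    have h₄ : (2 * m + 1 + 1) / 2 = m + 1 := by omega
    rw [spinePos, if_neg (Nat.not_even_two_mul_add_one m), h₄]
    omega

lemma spinePos_ne_spinePos_succ (d k : ℕ) : spinePos d k ≠ spinePos d (k + 1) := by
  obtain hk | hk := Nat.even_or_odd k
  · rw [spinePos, spinePos, if_pos hk, if_neg (by simpa [Nat.even_add_one] using hk)]
    omega
  · rw [spinePos, spinePos, if_neg (by simpa using hk),
      if_pos (by simpa [Nat.even_add_one] using hk)]
    omega

lemma zigzagEdge_succ_mul (d k : ℕ) :
    zigzagEdge d ((k + 1) * d) = s(spinePos d k, spinePos d (k + 1)) :=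
  (Sym2.mem_and_mem_iff (spinePos_ne_spinePos_succ d k)).1
    ⟨spinePos_mem_zigzagEdge (by linarith) le_rfl, spinePos_mem_zigzagEdge le_rfl (by linarith)⟩

end Staircase

section ParabolaDrawing

/-- The point with abscissa `x` on the standard parabola, on which the vertices are placed. -/
def parabola (x : ℝ) : ℝ × ℝ := (x, x ^ 2)

lemma parabola_injective : Function.Injective parabola := fun _ _ h => congrArg Prod.fst h

lemma of_mem_openSegment_parabola {a b : ℝ} (hab : a < b) {p : ℝ × ℝ}
    (hp : p ∈ openSegment ℝ (parabola a) (parabola b)) :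
    a < p.1 ∧ p.1 < b ∧ p.2 - p.1 ^ 2 = (p.1 - a) * (b - p.1) := by
  rw [openSegment_eq_image_lineMap] at hp
  obtain ⟨t, ⟨h₀, h₁⟩, rfl⟩ := hp
  simp only [parabola, AffineMap.lineMap_apply, vsub_eq_sub, vadd_eq_add, Prod.fst_add,
    Prod.snd_add, Prod.smul_fst, Prod.smul_snd, Prod.fst_sub, Prod.snd_sub, smul_eq_mul]
  exact ⟨by nlinarith, by nlinarith, by ring⟩

lemma parabola_notMem_openSegment {a b : ℝ} (hab : a < b) (x : ℝ) :
    parabola x ∉ openSegment ℝ (parabola a) (parabola b) := fun hx => by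
  obtain ⟨h₁, h₂, h₃⟩ := of_mem_openSegment_parabola hab hx
  have := mul_pos (sub_pos.2 h₁) (sub_pos.2 h₂)
  simp only [parabola] at h₃ this
  linarith

lemma ends_lt_of_mem_chords {a b a' b' : ℝ} (hab : a < b) (hab' : a' < b')
    (hne : ¬(a = a' ∧ b = b')) {p : ℝ × ℝ} (hp : p ∈ openSegment ℝ (parabola a) (parabola b))
    (hp' : p ∈ openSegment ℝ (parabola a') (parabola b')) :
    a < a' ∧ b < b' ∨ a' < a ∧ b' < b := by
  obtain ⟨h₁, h₂, h₃⟩ := of_mem_openSegment_parabola hab hp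
  obtain ⟨h₁', h₂', h₃'⟩ := of_mem_openSegment_parabola hab' hp'
  have height : (p.1 - a) * (b - p.1) = (p.1 - a') * (b' - p.1) := h₃.symm.trans h₃'
  rcases lt_trichotomy a a' with h | rfl | h
  · refine .inl ⟨h, lt_of_not_ge fun hb => height.not_gt ?_⟩
    exact mul_lt_mul (by linarith) (by linarith) (by linarith) (by linarith)
  · refine absurd ⟨rfl, ?_⟩ hne
    linarith [mul_left_cancel₀ (sub_pos.2 h₁).ne' height]
  · refine .inr ⟨h, lt_of_not_ge fun hb => height.not_lt ?_⟩
    exact mul_lt_mul (by linarith) (by linarith) (by linarith) (by linarith)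

lemma subsingleton_inter_chords {a b a' b' : ℝ} (hab : a < b) (hab' : a' < b')
    (hne : ¬(a = a' ∧ b = b')) :
    (openSegment ℝ (parabola a) (parabola b) ∩
      openSegment ℝ (parabola a') (parabola b')).Subsingleton := by
  rintro p ⟨hp, hp'⟩ q ⟨hq, hq'⟩
  have hends := ends_lt_of_mem_chords hab hab' hne hp hp'
  obtain ⟨-, -, h₁⟩ := of_mem_openSegment_parabola hab hp
  obtain ⟨-, -, h₂⟩ := of_mem_openSegment_parabola hab' hp'
  obtain ⟨-, -, h₃⟩ := of_mem_openSegment_parabola hab hq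
  obtain ⟨-, -, h₄⟩ := of_mem_openSegment_parabola hab' hq'
  have hslope : a + b - (a' + b') ≠ 0 := by
    rcases hends with ⟨h, h'⟩ | ⟨h, h'⟩
    exacts [(by linarith : _ < (0 : ℝ)).ne, (by linarith : (0 : ℝ) < _).ne']
  have hfst : p.1 = q.1 := mul_left_cancel₀ hslope (by linarith)
  exact Prod.ext hfst (by rw [hfst] at h₁; linarith)

variable {V : Type*} [LinearOrder V] (x : V ↪o ℝ) {G : SimpleGraph V}

lemma inf_lt_sup_of_mem_edgeSet {e : Sym2 V} (he : e ∈ G.edgeSet) : e.inf < e.sup := by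
  induction e with
  | h u v => exact inf_lt_sup.2 (G.ne_of_adj he)

lemma mk_inf_sup (e : Sym2 V) : s(e.inf, e.sup) = e := Sym2.sortEquiv.symm_apply_apply e

lemma map_inf_lt_map_sup (e : G.edgeSet) : x (e : Sym2 V).inf < x (e : Sym2 V).sup :=
  x.lt_iff_lt.2 (inf_lt_sup_of_mem_edgeSet e.2)

lemma ends_ne {e f : G.edgeSet} (hne : f ≠ e) :
    ¬(x (e : Sym2 V).inf = x (f : Sym2 V).inf ∧ x (e : Sym2 V).sup = x (f : Sym2 V).sup) := by
  rw [x.eq_iff_eq, x.eq_iff_eq, Sym2.inf_eq_inf_and_sup_eq_sup, Subtype.coe_inj]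
  exact hne.symm

variable (G) in
/-- The straight-line drawing in which the vertex `v` is the point of the parabola with abscissa
`x v`. -/
noncomputable def parabolaDrawing : Drawing G where
  point v := parabola (x v)
  point_injective := parabola_injective.comp x.injective
  arc e := Path.segment (parabola (x (e : Sym2 V).inf)) (parabola (x (e : Sym2 V).sup))
  arc_continuous e := Path.continuous _
  arc_injective e := Path.segment_injective_of_ne
    (parabola_injective.ne (map_inf_lt_map_sup x e).ne)
  arc_ends e := by
    conv_rhs => rw [← mk_inf_sup (e : Sym2 V)]
    simp
  arc_avoids e t ht v h := parabola_notMem_openSegment (map_inf_lt_map_sup x e) (x v)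
    (h ▸ lineMap_mem_openSegment ℝ _ _ ht)

lemma interior_parabolaDrawing_subset (e : G.edgeSet) :
    (parabolaDrawing x G).interior e ⊆
      openSegment ℝ (parabola (x (e : Sym2 V).inf)) (parabola (x (e : Sym2 V).sup)) := by
  rintro _ ⟨t, ht, rfl⟩
  exact lineMap_mem_openSegment ℝ _ _ ht

/-- The end-vertices of `e` and `f` alternate in the order of the vertices. On a parabola, exactly
the edges that alternate cross each other. -/
def Alternate (e f : Sym2 V) : Prop :=
  e.inf < f.inf ∧ f.inf < e.sup ∧ e.sup < f.sup ∨ f.inf < e.inf ∧ e.inf < f.sup ∧ f.sup < e.sup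

lemma Alternate.symm {e f : Sym2 V} (h : Alternate e f) : Alternate f e := Or.symm h

lemma alternate_of_mem_interior {e f : G.edgeSet} (hne : f ≠ e) {p : ℝ × ℝ}
    (he : p ∈ (parabolaDrawing x G).interior e) (hf : p ∈ (parabolaDrawing x G).interior f) :
    Alternate (e : Sym2 V) f := by
  have he := interior_parabolaDrawing_subset x e he
  have hf := interior_parabolaDrawing_subset x f hf
  obtain ⟨h₁, h₂, -⟩ := of_mem_openSegment_parabola (map_inf_lt_map_sup x e) he
  obtain ⟨h₁', h₂', -⟩ := of_mem_openSegment_parabola (map_inf_lt_map_sup x f) hf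
  rcases ends_lt_of_mem_chords (map_inf_lt_map_sup x e) (map_inf_lt_map_sup x f)
    (ends_ne x hne) he hf with ⟨h, h'⟩ | ⟨h, h'⟩
  · exact .inl ⟨x.lt_iff_lt.1 h, x.lt_iff_lt.1 (h₁'.trans h₂), x.lt_iff_lt.1 h'⟩
  · exact .inr ⟨x.lt_iff_lt.1 h, x.lt_iff_lt.1 (h₁.trans h₂'), x.lt_iff_lt.1 h'⟩

lemma isKPlanar_of_encard_alternate_le (x : V ↪o ℝ) {k : ℕ}
    (hk : ∀ e ∈ G.edgeSet, {f ∈ G.edgeSet | Alternate e f}.encard ≤ k) : IsKPlanar G k := by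
  refine ⟨parabolaDrawing x G, fun e => le_trans ?_ (hk e e.2)⟩
  refine Set.encard_le_encard_of_injOn (f := fun c => (c.1 : Sym2 V)) ?_ ?_
  · rintro ⟨f, p⟩ ⟨hne, he, hf⟩
    exact ⟨f.2, alternate_of_mem_interior x hne he hf⟩
  · rintro ⟨f, p⟩ ⟨hne, hpe, hpf⟩ ⟨g, q⟩ ⟨-, hqe, hqg⟩ hfg
    obtain rfl : f = g := Subtype.ext hfg
    refine Prod.ext rfl (subsingleton_inter_chords (map_inf_lt_map_sup x e)
      (map_inf_lt_map_sup x f) (ends_ne x hne) ⟨?_, ?_⟩ ⟨?_, ?_⟩)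
    all_goals exact interior_parabolaDrawing_subset x _ ‹_›

end ParabolaDrawing

section Caterpillar

variable {V : Type*} {G : SimpleGraph V}

lemma exists_fin_mem_block {d σ t : ℕ} (hd : 0 < d) (hσ : 0 < σ) (ht : t ≤ σ * d) :
    ∃ k : Fin σ, t ∈ Finset.Icc (k * d) ((k + 1) * d) := by
  simp only [Finset.mem_Icc]
  rcases ht.lt_or_eq with ht | rfl
  · exact ⟨⟨t / d, (Nat.div_lt_iff_lt_mul hd).2 ht⟩, Nat.div_mul_le_self t d,
      (Nat.lt_mul_of_div_lt (Nat.lt_succ_self (t / d)) hd).le⟩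
  · exact ⟨⟨σ - 1, by omega⟩, Nat.mul_le_mul_right d (by simp), by simp [Nat.sub_add_cancel hσ]⟩

lemma exists_spinePos_extension {d σ : ℕ} (p : pathGraph σ ↪g G)
    (hleaf : ∀ v ∉ Set.range p, ∃ k, ∀ u, G.Adj v u ↔ u = p k)
    (g : ∀ k, G.neighborSet (p k) ≃ Finset.Icc (k * d) ((k + 1) * d))
    (hg : ∀ k l (hl : p l ∈ G.neighborSet (p k)), (g k ⟨p l, hl⟩ : ℕ) = max (k : ℕ) l * d) (v : V) :
    ∃ z : ℤ, (∀ k, p k = v → z = spinePos d k) ∧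
      ∀ k (hv : v ∈ G.neighborSet (p k)), zigzagEdge d (g k ⟨v, hv⟩) = s(spinePos d k, z) := by
  by_cases hv : v ∈ Set.range p
  · obtain ⟨l, rfl⟩ := hv
    refine ⟨spinePos d l, fun k hk => by rw [p.injective hk], fun k hl => ?_⟩
    rw [hg]
    rcases pathGraph_adj.1 (p.map_adj_iff.1 hl) with h | h
    · rw [← h, max_eq_right (Nat.le_add_right _ 1), zigzagEdge_succ_mul]
    · rw [← h, max_eq_left (Nat.le_add_right _ 1), zigzagEdge_succ_mul, Sym2.eq_swap]
  · obtain ⟨k, hk⟩ := hleaf v hv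
    have hkv : v ∈ G.neighborSet (p k) := ((hk _).2 rfl).symm
    obtain ⟨h₁, h₂⟩ := Finset.mem_Icc.1 (g k ⟨v, hkv⟩).2
    obtain ⟨z, hz⟩ := spinePos_mem_zigzagEdge h₁ h₂
    refine ⟨z, fun l hl => (hv ⟨l, hl⟩).elim, fun l hlv => ?_⟩
    obtain rfl : l = k := p.injective ((hk _).1 hlv.symm)
    exact hz

variable [Fintype V]

lemma deg_eq_degree (G : SimpleGraph V) (v : V) [Fintype (G.neighborSet v)] :
    deg G v = G.degree v := by
  unfold deg
  congr!

lemma notMem_spine_iff {v : V} : v ∉ spine G ↔ ∃! w, G.Adj v w := by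
  classical
  rw [← degree_eq_one_iff_existsUnique_adj, ← deg_eq_degree]
  exact not_not

lemma exists_mem_spine_forall_adj_iff (hG : G.Connected) (hs : (spine G).Nonempty) {w : V}
    (hw : w ∉ spine G) : ∃ v ∈ spine G, ∀ u, G.Adj w u ↔ u = v := by
  classical
  obtain ⟨v, hwv, hv⟩ := notMem_spine_iff.1 hw
  refine ⟨v, by_contra fun hvs => ?_, fun u => ⟨hv u, fun h => h ▸ hwv⟩⟩
  obtain ⟨s, hs⟩ := hs
  obtain ⟨p, hp⟩ := hG.exists_isPath w s
  match p, hp with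
  | .nil, _ => exact hw hs
  | .cons hwu .nil, _ => exact hvs (hv _ hwu ▸ hs)
  | .cons hwu (.cons hut q), hp =>
    obtain rfl := hv _ hwu
    have hwt := (notMem_spine_iff.1 hvs).unique hwu.symm hut
    simp [hwt] at hp

lemma IsRegularCaterpillar.card_eq {Δ : ℕ} (hG : IsRegularCaterpillar G Δ) :
    Fintype.card V = (spine G).ncard * (Δ - 1) + 2 := by
  classical
  have hdeg : ∀ v, G.degree v = 1 + if v ∈ spine G then Δ - 1 else 0 := fun v => by
    have := hG.two_le
    rw [← deg_eq_degree]
    split_ifs with hv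
    · rw [hG.degree_eq v hv]
      omega
    · exact not_not.1 hv
  have hsum := G.sum_degrees_eq_twice_card_edges
  simp only [hdeg, Finset.sum_add_distrib, Finset.sum_ite, Finset.sum_const, smul_eq_mul,
    mul_one, mul_zero, add_zero, Finset.card_univ] at hsum
  have hspine : (Finset.univ.filter (· ∈ spine G)).card = (spine G).ncard := by
    rw [← Set.ncard_coe_finset]
    simp
  rw [hspine] at hsum
  have := hG.isCaterpillar.1.card_edgeFinset
  omega

lemma IsRegularCaterpillar.exists_pathGraph_embedding {Δ : ℕ} (hG : IsRegularCaterpillar G Δ) :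
    ∃ (σ : ℕ) (p : pathGraph σ ↪g G), Set.range p = spine G := by
  obtain ⟨σ, ⟨φ⟩⟩ := hG.isCaterpillar.2
  refine ⟨σ, (Embedding.induce (spine G)).comp φ.symm.toEmbedding, ?_⟩
  ext v
  constructor
  · rintro ⟨k, rfl⟩
    exact (φ.symm k).2
  · exact fun hv => ⟨φ ⟨v, hv⟩, by simp⟩

/-- In the numbering of the edges behind a zigzag drawing, the edges at the `k`-th vertex of the
spine get the numbers from `k * d` to `(k + 1) * d`, the extreme ones being those of the edges to
its neighbours on the spine. -/
lemma exists_edge_numbering {d σ : ℕ} (hd : 0 < d) (p : pathGraph σ ↪g G) {k : Fin σ}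
    (hdeg : deg G (p k) = d + 1) :
    ∃ g : G.neighborSet (p k) ≃ Finset.Icc (k * d) ((k + 1) * d),
      ∀ (l : Fin σ) (hl : p l ∈ G.neighborSet (p k)), (g ⟨p l, hl⟩ : ℕ) = max (k : ℕ) l * d := by
  classical
  have hadj : ∀ l, p l ∈ G.neighborSet (p k) → (k : ℕ) + 1 = l ∨ (l : ℕ) + 1 = k := fun l hl =>
    pathGraph_adj.1 (p.map_adj_iff.1 hl)
  have hcard : Fintype.card (G.neighborSet (p k)) = (Finset.Icc (k * d) ((k + 1) * d)).card := by
    rw [card_neighborSet_eq_degree, ← deg_eq_degree, hdeg, Nat.card_Icc, add_mul]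
    omega
  let s : Finset (G.neighborSet (p k)) := Finset.univ.filter fun w => ∃ l, p l = w
  let f : G.neighborSet (p k) → ℕ := fun w =>
    Function.extend p (fun l : Fin σ => max (k : ℕ) l * d) 0 w
  have hf : ∀ l hl, f ⟨p l, hl⟩ = max (k : ℕ) l * d := fun l _ => p.injective.extend_apply _ _ l
  suffices hs : s.image f ⊆ Finset.Icc (k * d) ((k + 1) * d) ∧ Set.InjOn f s by
    obtain ⟨g, hg⟩ := Finset.exists_equiv_extend_of_card_eq hcard hs.1 hs.2
    exact ⟨g, fun l hl => (hg _ (by simp [s])).trans (hf l hl)⟩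
  constructor
  · intro t ht
    obtain ⟨⟨_, hl⟩, hw, rfl⟩ := Finset.mem_image.1 ht
    obtain ⟨l, rfl⟩ := (Finset.mem_filter.1 hw).2
    have := hadj l hl
    rw [hf, Finset.mem_Icc]
    exact ⟨Nat.mul_le_mul_right d (by omega), Nat.mul_le_mul_right d (by omega)⟩
  · rintro ⟨_, hl⟩ hw ⟨_, hm⟩ hw' h
    obtain ⟨l, rfl⟩ := (Finset.mem_filter.1 hw).2
    obtain ⟨m, rfl⟩ := (Finset.mem_filter.1 hw').2
    rw [hf, hf] at h
    have h₁ := hadj l hl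
    have h₂ := hadj m hm
    have h₃ := Nat.eq_of_mul_eq_mul_right hd h
    obtain rfl : l = m := Fin.ext (by omega)
    rfl

lemma exists_map_edgeSet_eq_zigzagEdge {d σ : ℕ} (hd : 0 < d) (hσ : 0 < σ) (p : pathGraph σ ↪g G)
    (hdeg : ∀ k, deg G (p k) = d + 1) (hleaf : ∀ v ∉ Set.range p, ∃ k, ∀ u, G.Adj v u ↔ u = p k) :
    ∃ pos : V → ℤ, Sym2.map pos '' G.edgeSet = zigzagEdge d '' Set.Iic (σ * d) := by
  choose g hg using fun k => exists_edge_numbering hd p (hdeg k)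
  choose pos hspine hnbr using exists_spinePos_extension p hleaf g hg
  have hedge : ∀ k v (hv : v ∈ G.neighborSet (p k)),
      Sym2.map pos s(p k, v) = zigzagEdge d (g k ⟨v, hv⟩) := fun k v hv => by
    rw [hnbr, Sym2.map_mk, hspine _ k rfl]
  have hincident : ∀ e ∈ G.edgeSet, ∃ k, ∃ v ∈ G.neighborSet (p k), e = s(p k, v) := by
    rintro ⟨u, v⟩ huv
    by_cases hu : u ∈ Set.range p
    · obtain ⟨k, rfl⟩ := hu
      exact ⟨k, v, huv, rfl⟩
    · obtain ⟨k, hk⟩ := hleaf u hu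
      obtain rfl := (hk v).1 huv
      exact ⟨k, u, huv.symm, Sym2.eq_swap⟩
  refine ⟨pos, Set.Subset.antisymm ?_ ?_⟩
  · rintro _ ⟨e, he, rfl⟩
    obtain ⟨k, v, hv, rfl⟩ := hincident e he
    have hle := (Finset.mem_Icc.1 (g k ⟨v, hv⟩).2).2
    exact ⟨_, hle.trans (Nat.mul_le_mul_right d k.2), (hedge k v hv).symm⟩
  · rintro _ ⟨t, ht, rfl⟩
    obtain ⟨k, hk⟩ := exists_fin_mem_block hd hσ ht
    obtain ⟨⟨v, hv⟩, hgv⟩ := (g k).surjective ⟨t, hk⟩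
    exact ⟨s(p k, v), hv, by rw [hedge k v hv, hgv]⟩

lemma IsRegularCaterpillar.exists_map_edgeSet_eq {Δ : ℕ} (hG : IsRegularCaterpillar G Δ) :
    ∃ pos : V → ℤ,
      Sym2.map pos '' G.edgeSet = zigzagEdge (Δ - 1) '' {t | t + 2 ≤ Fintype.card V} := by
  obtain ⟨σ, p, hp⟩ := hG.exists_pathGraph_embedding
  have hΔ := hG.two_le
  have hσ : 0 < σ := by
    obtain ⟨_, k, -⟩ := hp ▸ hG.spine_nonempty
    exact k.pos
  have hcard : (spine G).ncard = σ := by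
    rw [← hp, ← Set.image_univ, Set.ncard_image_of_injective _ p.injective, Set.ncard_univ,
      Nat.card_fin]
  have hset : {t | t + 2 ≤ Fintype.card V} = Set.Iic (σ * (Δ - 1)) := by
    ext t
    rw [hG.card_eq, hcard, Set.mem_ofPred_eq, Set.mem_Iic, Nat.add_le_add_iff_right]
  rw [hset]
  refine exists_map_edgeSet_eq_zigzagEdge (by omega) hσ p (fun k => ?_) fun v hv => ?_
  · rw [hG.degree_eq (p k) (hp ▸ ⟨k, rfl⟩)]
    omega
  · obtain ⟨w, hw, h⟩ := exists_mem_spine_forall_adj_iff hG.isCaterpillar.1.connected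
      hG.spine_nonempty (hp ▸ hv)
    obtain ⟨k, rfl⟩ := hp.symm ▸ hw
    exact ⟨k, h⟩

end Caterpillar

section Rotation

variable {n : ℕ} [NeZero n]

/-- The residue of `z` modulo `n`, as a vertex of the packing. -/
def residue (n : ℕ) [NeZero n] (z : ℤ) : Fin n :=
  ⟨(z % n).toNat, by
    have := Int.emod_lt_of_pos z (Nat.cast_pos.2 (NeZero.pos n))
    have := NeZero.pos n
    omega⟩

lemma coe_residue (z : ℤ) : ((residue n z : ℕ) : ℤ) = z % n :=
  Int.toNat_of_nonneg (Int.emod_nonneg z (Nat.cast_ne_zero.2 (NeZero.ne n)))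

lemma residue_eq_of_modEq {z : ℤ} {y : Fin n} (h : z ≡ (y : ℕ) [ZMOD n]) : residue n z = y := by
  rw [← Fin.val_inj, ← Nat.cast_inj (R := ℤ), coe_residue, h, ← Int.natCast_mod,
    Nat.mod_eq_of_lt y.2]

lemma exists_residue_eq (a : ℤ) (y : Fin n) : ∃ z, a ≤ z ∧ z < a + n ∧ residue n z = y := by
  obtain ⟨w, h₀, h₁, h₂⟩ :=
    Int.existsUnique_equiv ((y : ℕ) - a) (Nat.cast_pos.2 (NeZero.pos n))
  exact ⟨a + w, by omega, by omega, residue_eq_of_modEq (by simpa using h₂.add_left a)⟩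

/-- The `t`-th edge of the zigzag drawing, shifted by `i` and wrapped around the cycle of the
residues modulo `n`. -/
def cyclicEdge (n : ℕ) [NeZero n] (d i t : ℕ) : Sym2 (Fin n) :=
  (zigzagEdge d t).map fun z => residue n (z + i)

lemma IsRegularCaterpillar.exists_equiv_fin {V : Type*} [Fintype V] {G : SimpleGraph V} {Δ : ℕ}
    (hG : IsRegularCaterpillar G Δ) (hn : Fintype.card V = n) (i : ℕ) :
    ∃ f : V ≃ Fin n,
      (G.map f.toEmbedding).edgeSet = cyclicEdge n (Δ - 1) i '' {t | t + 2 ≤ n} := by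
  obtain ⟨pos, hpos⟩ := hG.exists_map_edgeSet_eq
  rw [hn] at hpos
  obtain ⟨N, rfl⟩ : ∃ N, n = N + 2 := ⟨_, hn ▸ hG.card_eq⟩
  have hsurj : Function.Surjective fun v => residue (N + 2) (pos v + i) := fun y => by
    obtain ⟨z, h₁, h₂, hz⟩ := exists_residue_eq (rightSteps (Δ - 1) N - (N + 1) + i : ℤ) y
    push_cast at h₂
    obtain ⟨t, ht, hzt⟩ :=
      exists_mem_zigzagEdge (Δ - 1) (N := N) (z := z - i) (by omega) (by omega)
    obtain ⟨e, -, he⟩ := hpos.ge ⟨t, Nat.add_le_add_right ht 2, rfl⟩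
    obtain ⟨v, -, hv⟩ := Sym2.mem_map.1 (he ▸ hzt)
    exact ⟨v, by simpa [hv] using hz⟩
  have hbij := hsurj.bijective_of_nat_card_le (by simp [hn])
  refine ⟨.ofBijective _ hbij, ?_⟩
  calc _ = Sym2.map (fun v => residue (N + 2) (pos v + i)) '' G.edgeSet := edgeSet_map _ G
    _ = Sym2.map (fun z => residue (N + 2) (z + i)) '' (Sym2.map pos '' G.edgeSet) := by
      rw [← Set.image_comp, ← Sym2.map_comp]
      rfl
    _ = _ := by
      rw [hpos, ← Set.image_comp]
      rfl

lemma cyclicEdge_inf_sup {d i t : ℕ} (hd : 0 < d) (hi : 2 * i + 2 ≤ n) (ht : t + 2 ≤ n) :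
    ((cyclicEdge n d i t).inf + (t + 1) = rightSteps d t + i ∧
        ((cyclicEdge n d i t).sup : ℕ) = rightSteps d t + i) ∨
      ((cyclicEdge n d i t).inf : ℕ) = rightSteps d t + i ∧
        (cyclicEdge n d i t).sup + (t + 1) = rightSteps d t + i + n := by
  have hr := two_mul_rightSteps_le hd t
  have hright : (residue n (rightSteps d t + i) : ℤ) = rightSteps d t + i := by
    rw [coe_residue, Int.emod_eq_of_lt] <;> omega
  rw [cyclicEdge, zigzagEdge, Sym2.map_mk, Sym2.inf_mk, Sym2.sup_mk,
    Fin.val_strictMono.monotone.map_min, Fin.val_strictMono.monotone.map_max]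
  rcases le_or_gt (t + 1) (rightSteps d t + i) with h | h
  · have hleft : (residue n (rightSteps d t - (t + 1) + i) : ℤ)
        = rightSteps d t - (t + 1) + i := by
      rw [coe_residue, Int.emod_eq_of_lt] <;> omega
    omega
  · have hleft : (residue n (rightSteps d t - (t + 1) + i) : ℤ)
        = rightSteps d t - (t + 1) + i + n := by
      rw [coe_residue, ← Int.add_emod_right, Int.emod_eq_of_lt] <;> omega
    omega

lemma cyclicEdge_ne {h d d' i j t t' : ℕ} (hd : 0 < d) (hd' : d' ∣ d) (hij : i < j) (hj : j < h)
    (hn : 2 * h + d ≤ n) (ht : t + 2 ≤ n) (ht' : t' + 2 ≤ n) :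
    cyclicEdge n d i t ≠ cyclicEdge n d' j t' := fun heq => by
  have hpos := Nat.pos_of_dvd_of_pos hd' hd
  have hends := cyclicEdge_inf_sup (n := n) (i := i) hd (by omega) ht
  have hends' := cyclicEdge_inf_sup (n := n) (i := j) hpos (by omega) ht'
  rw [← heq] at hends'
  have hr := two_mul_rightSteps_le hd t
  have hr' := two_mul_rightSteps_le hpos t'
  have hs := le_two_mul_rightSteps_add hd t
  -- If only one of the edges wrapped around, both would be short, yet their lengths sum to `n`.
  have hsteps : t = t' ∧ rightSteps d t + i = rightSteps d' t' + j := by omega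
  obtain ⟨rfl, hsteps⟩ := hsteps
  have := rightSteps_le_of_dvd hd hd' t
  omega

lemma index_le_of_alternate {h D d d' i j t t' : ℕ} (hd : 0 < d) (hd' : 0 < d') (hdD : d ≤ D)
    (hdD' : d' ≤ D) (hi : i < h) (hj : j < h) (hn : 2 * h ≤ n) (ht : t + 2 ≤ n) (ht' : t' + 2 ≤ n)
    (halt : Alternate (cyclicEdge n d i t) (cyclicEdge n d' j t')) : t' ≤ t + (D + 4 * h) := by
  have hr := two_mul_rightSteps_le hd t
  have hr' := two_mul_rightSteps_le hd' t'
  have hs := le_two_mul_rightSteps_add hd t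
  have hs' := le_two_mul_rightSteps_add hd' t'
  simp only [Alternate, Fin.lt_def] at halt
  rcases cyclicEdge_inf_sup (n := n) (i := j) hd' (by omega) ht' with hf | hf
  · have : t' < 2 * h := by omega
    omega
  rcases cyclicEdge_inf_sup (n := n) (i := i) hd (by omega) ht with he | he
  · have : ((cyclicEdge n d i t).sup : ℕ) < 2 * h := by omega
    have : ((cyclicEdge n d' j t').inf : ℕ) < 2 * h := by omega
    omega
  · -- The crossing chords are nearly parallel, so that their lengths are nearly equal.
    have : (cyclicEdge n d i t).inf + (cyclicEdge n d i t).sup ≤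
        (cyclicEdge n d' j t').inf + (cyclicEdge n d' j t').sup + (D + 2 * h) := by omega
    have : (cyclicEdge n d' j t').inf + (cyclicEdge n d' j t').sup ≤
        (cyclicEdge n d i t).inf + (cyclicEdge n d i t).sup + (D + 2 * h) := by omega
    omega

lemma encard_alternate_le {h D : ℕ} {d : Fin h → ℕ} (hd : ∀ i, 0 < d i) (hdD : ∀ i, d i ≤ D)
    (hn : 2 * h ≤ n) {S : Set (Sym2 (Fin n))}
    (hS : ∀ e ∈ S, ∃ i, e ∈ cyclicEdge n (d i) i '' {t | t + 2 ≤ n}) {e : Sym2 (Fin n)}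
    (he : e ∈ S) : {f ∈ S | Alternate e f}.encard ≤ (h * (2 * (D + 4 * h) + 1) : ℕ) := by
  obtain ⟨i, t, ht, rfl⟩ := hS e he
  let close : Finset ℕ := Finset.Icc (t - (D + 4 * h)) (t + (D + 4 * h))
  let crossing : Finset (Sym2 (Fin n)) :=
    Finset.univ.biUnion fun j : Fin h => close.image (cyclicEdge n (d j) j)
  have hsub : {f ∈ S | Alternate (cyclicEdge n (d i) i t) f} ⊆ crossing := by
    rintro f ⟨hf, halt⟩
    obtain ⟨j, t', ht', rfl⟩ := hS f hf
    have hle := index_le_of_alternate (hd i) (hd j) (hdD i) (hdD j) i.2 j.2 hn ht ht' halt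
    have hge :=
      index_le_of_alternate (hd j) (hd i) (hdD j) (hdD i) j.2 i.2 hn ht' ht halt.symm
    have hclose : t' ∈ close := Finset.mem_Icc.2 ⟨by omega, hle⟩
    exact Finset.mem_biUnion.2 ⟨j, Finset.mem_univ j, Finset.mem_image_of_mem _ hclose⟩
  have hcard : crossing.card ≤ h * (2 * (D + 4 * h) + 1) := by
    refine (Finset.card_biUnion_le_card_mul _ _ _ fun j _ => Finset.card_image_le).trans ?_
    rw [Finset.card_univ, Fintype.card_fin, Nat.card_Icc]
    exact Nat.mul_le_mul_left h (by omega)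
  exact (Set.encard_le_encard hsub).trans (by
    rw [Set.encard_coe_eq_coe_finsetCard]
    exact Nat.cast_le.2 hcard)

end Rotation

section Packing

lemma dvd_of_le_of_succ_dvd {h : ℕ} {d : Fin h → ℕ}
    (hd : ∀ i j : Fin h, (i : ℕ) + 1 = j → d j ∣ d i) {i j : Fin h} (hij : i ≤ j) : d j ∣ d i := by
  obtain ⟨j, hj⟩ := j
  replace hij : (i : ℕ) ≤ j := hij
  induction j, hij using Nat.le_induction with
  | base => rfl
  | succ j _ ih => exact (hd ⟨j, by omega⟩ _ rfl).trans (ih _)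

lemma exists_isPacking_edgeSet_subset {n h : ℕ} [NeZero n] {V : Fin h → Type*}
    [∀ i, Fintype (V i)] {C : ∀ i, SimpleGraph (V i)} {Δ : Fin h → ℕ}
    (hV : ∀ i, Fintype.card (V i) = n) (hC : ∀ i, IsRegularCaterpillar (C i) (Δ i))
    (hdvd : ∀ i j, i ≤ j → Δ j - 1 ∣ Δ i - 1) (hn : ∀ i, 2 * h + (Δ i - 1) ≤ n) :
    ∃ G : SimpleGraph (Fin n), IsPacking C G ∧
      ∀ e ∈ G.edgeSet, ∃ i : Fin h, e ∈ cyclicEdge n (Δ i - 1) i '' {t | t + 2 ≤ n} := by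
  choose f hf using fun i => (hC i).exists_equiv_fin (hV i) i
  have hdisj : ∀ i j, i < j → Disjoint ((C i).map (f i).toEmbedding).edgeSet
      ((C j).map (f j).toEmbedding).edgeSet := fun i j hij => by
    have hpos : 0 < Δ i - 1 := Nat.sub_pos_of_lt (hC i).two_le
    rw [hf, hf]
    exact Set.disjoint_image_image fun t ht t' ht' =>
      cyclicEdge_ne hpos (hdvd i j hij.le) hij j.2 (hn i) ht ht'
  refine ⟨⨆ i, (C i).map (f i).toEmbedding,
    ⟨f, le_iSup fun i => (C i).map (f i).toEmbedding, fun i j hij => ?_⟩, fun e he => ?_⟩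
  · exact hij.lt_or_gt.elim (hdisj i j) fun hji => (hdisj j i hji).symm
  · rw [edgeSet_iSup, Set.mem_iUnion] at he
    exact he.imp fun i hi => hf i ▸ hi

end Packing

end CaterpillarPacking

open CaterpillarPacking in
theorem theorem4_general {n h : ℕ} (hh : 0 < h) {V : Fin h → Type*} [∀ i, Fintype (V i)]
    {Δ : Fin h → ℕ} {C : ∀ i, SimpleGraph (V i)} (hV : ∀ i, Fintype.card (V i) = n)
    (hC : ∀ i, IsRegularCaterpillar (C i) (Δ i))
    (hdvd : ∀ i j : Fin h, (i : ℕ) + 1 = j → Δ j - 1 ∣ Δ i - 1)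
    (hn : 2 * h + (Δ ⟨0, hh⟩ - 1) ≤ n) :
    ∃ G : SimpleGraph (Fin n), IsPacking C G ∧
      IsKPlanar G (9 * (Δ ⟨0, hh⟩ * h + h ^ 2)) := by
  have : NeZero n := ⟨by omega⟩
  have hpos : ∀ i, 0 < Δ i - 1 := fun i => Nat.sub_pos_of_lt (hC i).two_le
  have hdvd_le : ∀ i j, i ≤ j → Δ j - 1 ∣ Δ i - 1 := fun i j =>
    dvd_of_le_of_succ_dvd (d := fun i => Δ i - 1) hdvd
  have hle : ∀ i, Δ i - 1 ≤ Δ ⟨0, hh⟩ - 1 := fun i =>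
    Nat.le_of_dvd (hpos _) (hdvd_le _ i (Nat.zero_le _))
  obtain ⟨G, hG, hedges⟩ := exists_isPacking_edgeSet_subset hV hC hdvd_le fun i => by
    linarith [hle i]
  refine ⟨G, hG, isKPlanar_of_encard_alternate_le
    ((Fin.valOrderEmb n).trans Nat.castOrderEmbedding) fun e he => ?_⟩
  refine (encard_alternate_le hpos hle (by omega) hedges he).trans (Nat.cast_le.2 ?_)
  calc h * (2 * (Δ ⟨0, hh⟩ - 1 + 4 * h) + 1) ≤ h * (9 * (Δ ⟨0, hh⟩ + h)) :=
        Nat.mul_le_mul_left h (by omega)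
    _ = 9 * (Δ ⟨0, hh⟩ * h + h ^ 2) := by ring

theorem theorem4 :
    ∃ K : ℕ, ∀ (n h : ℕ) (hh : 0 < h) (Δ : Fin h → ℕ) (C : Fin h → SimpleGraph (Fin n)),
      (∀ i, CaterpillarPacking.IsRegularCaterpillar (C i) (Δ i)) →
      (∀ i j : Fin h, (i : ℕ) + 1 = (j : ℕ) → (Δ j - 1) ∣ (Δ i - 1)) →
      (∀ i, Δ i + h ≤ n) →
      2 * h + (Δ ⟨0, hh⟩ - 1) ≤ n →
      ∃ (G : SimpleGraph (Fin n)) (k : ℕ),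
        CaterpillarPacking.IsPacking C G ∧
        CaterpillarPacking.IsKPlanar G k ∧
        k ≤ K * (Δ ⟨0, hh⟩ * h + h ^ 2) :=
  ⟨9, fun n _ hh _ _ hC hdvd _ hn =>
    let ⟨G, hpack, hk⟩ := theorem4_general hh (fun _ => Fintype.card_fin n) hC hdvd hn
    ⟨G, _, hpack, hk, le_rfl⟩⟩
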